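/- Let $Q=[-1,1]^2$, let $\{\varphi_k\}_{k\ge 0}$ be the orthonormal Legendre polynomials on $[-1,1]$, and for $f\in L_2(Q)$ put $\langle f,\varphi_{k,j}\rangle=\int_Q f(t,\tau)\varphi_k(t)\varphi_j(\tau)\,dt\,d\tau$. Let $r\ge 1$ be an integer, $1\le s<\infty$, $1\le p\le\infty$ (with $1/p=0$ if $p=\infty$), $\mu>2r-1/s+1/2$, and let $$L^{\mu}_{s,2}=\Big\{f\in L_2(Q):\ \|f\|_{s,\mu}:=\Big(\sum_{k,j=0}^{\infty}\max\{1,kj\}^{s\mu}\,|\langle f,\varphi_{k,j}\rangle|^s\Big)^{1/s}\le 1\Big\}.$$ For $f\in L^\mu_{s,2}$ the mixed derivative is $f^{(r,r)}(t,\tau)=\sum_{k,j\ge r}\langle f,\varphi_{k,j}\rangle\varphi_k^{(r)}(t)\varphi_j^{(r)}(\tau)$. For $n\in\mathbb N$ let $\Gamma_n=\{(k,j): kj\le rn-1,\ k,j=r,\dots,n-1\}$, and for a double sequence $y=(y_{k,j})_{k,j\ge0}$ of real numbers let $\mathcal D_n^{(r,r)}y(t,\tau)=\sum_{(k,j)\in\Gamma_n}y_{k,j}\,\varphi_k^{(r)}(t)\varphi_j^{(r)}(\tau)$.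 For $0<\delta<1$ call $y$ a $\delta$-perturbation of the coefficients of $f$ if $\|(\langle f,\varphi_{k,j}\rangle-y_{k,j})_{k,j\ge0}\|_{\ell_p}\le\delta$. Write $$X(\delta)=\Big(\delta^{-1}\ln^{1/p-1/s}\tfrac1\delta\Big)^{\frac1{\mu-1/p+1/s}}$$ and fix $c_1>0$ and $c_2$. Then: 1. For every $f\in L^\mu_{s,2}$ the series defining $f^{(r,r)}$ converges unconditionally in $L_2(Q)$. 2. For every $\delta_0\in(0,1)$ there is a constant $C>0$, depending only on $r,s,\mu,p,c_1,c_2,\delta_0$, such that for all $\delta\in(0,\delta_0]$, all $n\in\mathbb N$ with $c_1X(\delta)\le n\le c_2X(\delta)$, all $f\in L^\mu_{s,2}$ and all $\delta$-perturbations $y$ of its coefficients, $$\big\|f^{(r,r)}-\mathcal D_n^{(r,r)}y\big\|_{L_2(Q)}\le C\Big(\delta\ln^{1/s-1/p}\tfrac1\delta\Big)^{\frac{\mu-2r+1/s-1/2}{\mu-1/p+1/s}}\ln^{3/2-1/s}\tfrac1\delta .$$ 3. The method $\mathcal D_n^{(r,r)}$ uses $\mathrm{card}(\Gamma_n)$ perturbed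 Fourier–Legendre coefficients, and $$\mathrm{card}(\Gamma_n)\asymp n\ln n\asymp\Big(\delta^{-1}\ln^{\mu}\tfrac1\delta\Big)^{\frac1{\mu-1/p+1/s}},$$ that is, there are constants $a,b>0$ and $\delta_1\in(0,1)$, depending only on $r,s,\mu,p,c_1,c_2$, such that for all $\delta\in(0,\delta_1]$ and all $n\in\mathbb N$ with $c_1X(\delta)\le n\le c_2X(\delta)$ one has $a\,n\ln n\le\mathrm{card}(\Gamma_n)\le b\,n\ln n$ and $a\,Y(\delta)\le n\ln n\le b\,Y(\delta)$, where $Y(\delta)=(\delta^{-1}\ln^{\mu}\frac1\delta)^{1/(\mu-1/p+1/s)}$. -/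

import Mathlib

open MeasureTheory Set
open scoped ENNReal

noncomputable section

namespace MixedDeriv

/-- The orthonormal Legendre polynomial on `[-1, 1]` (Rodrigues formula):
`φ_k(t) = √(k + 1/2) (2 ^ k k!)⁻¹ (d/dt) ^ k (t ^ 2 - 1) ^ k`. -/
def legendre (k : ℕ) : Polynomial ℝ :=
  Polynomial.C (Real.sqrt (k + 1 / 2) * ((2 : ℝ) ^ k * (k.factorial : ℝ))⁻¹) *
    Polynomial.derivative^[k] ((Polynomial.X ^ 2 - 1) ^ k)

/-- The square `Q = [-1, 1] ^ 2`. -/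
def Q : Set (ℝ × ℝ) := Icc (-1) 1 ×ˢ Icc (-1) 1

/-- The Hilbert space `L₂(Q)`. -/
abbrev L2Q : Type := Lp ℝ 2 ((volume : Measure (ℝ × ℝ)).restrict Q)

/-- The function `(t, τ) ↦ φ_k^{(r)}(t) φ_j^{(r)}(τ)`, where `i = (k, j)`. -/
def legendreDeriv (r : ℕ) (i : ℕ × ℕ) (x : ℝ × ℝ) : ℝ :=
  (Polynomial.derivative^[r] (legendre i.1)).eval x.1 *
    (Polynomial.derivative^[r] (legendre i.2)).eval x.2

theorem memLp_legendreDeriv (r : ℕ) (i : ℕ × ℕ) :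
    MemLp (legendreDeriv r i) 2 ((volume : Measure (ℝ × ℝ)).restrict Q) := by
  have hc : Continuous (legendreDeriv r i) := by
    unfold legendreDeriv
    fun_prop
  have hQ : IsCompact Q := isCompact_Icc.prod isCompact_Icc
  obtain ⟨M, hM⟩ := hQ.exists_bound_of_continuousOn hc.continuousOn
  have : IsFiniteMeasure ((volume : Measure (ℝ × ℝ)).restrict Q) :=
    ⟨by rw [Measure.restrict_apply_univ]; exact hQ.measure_lt_top⟩
  refine MemLp.of_bound hc.aestronglyMeasurable M ?_
  exact (ae_restrict_iff' hQ.measurableSet).2 (Filter.Eventually.of_forall hM)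

/-- `φ_k^{(r)}(t) φ_j^{(r)}(τ)` as an element of `L₂(Q)`. -/
def legendreDerivL2 (r : ℕ) (i : ℕ × ℕ) : L2Q :=
  (memLp_legendreDeriv r i).toLp (legendreDeriv r i)

/-- The Fourier-Legendre coefficient `⟨f, φ_{k,j}⟩`, where `i = (k, j)`. -/
def coeff (f : L2Q) (i : ℕ × ℕ) : ℝ :=
  ∫ x in Q, f x * ((legendre i.1).eval x.1 * (legendre i.2).eval x.2)

/-- The summand `max(1, k j) ^ (s μ) |⟨f, φ_{k,j}⟩| ^ s` of `‖f‖_{s,μ} ^ s`. -/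
def normTerm (s μ : ℝ) (f : L2Q) (i : ℕ × ℕ) : ℝ :=
  (max 1 ((i.1 * i.2 : ℕ) : ℝ)) ^ (s * μ) * |coeff f i| ^ s

/-- The class `L^μ_{s,2}`: all `f ∈ L₂(Q)` with `‖f‖_{s,μ} < ∞` and `‖f‖_{s,μ} ≤ 1`. -/
def smoothClass (s μ : ℝ) : Set L2Q :=
  {f | Summable (normTerm s μ f) ∧ (∑' i, normTerm s μ f i) ^ (1 / s) ≤ 1}

/-- The terms of the series `∑_{k,j ≥ r} ⟨f, φ_{k,j}⟩ φ_k^{(r)}(t) φ_j^{(r)}(τ)`;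
the index set is `{(k, j) : r ≤ k, r ≤ j}`. -/
def mixedDerivTerm (r : ℕ) (f : L2Q) (i : Ici ((r, r) : ℕ × ℕ)) : L2Q :=
  coeff f i • legendreDerivL2 r i

/-- The mixed derivative `f^{(r,r)}`, the sum in `L₂(Q)` of the series above
(meaningful when the series is summable). -/
def mixedDeriv (r : ℕ) (f : L2Q) : L2Q := ∑' i, mixedDerivTerm r f i

/-- `y` is a perturbation of the double sequence `x` with error level `δ` in `ℓ_p`:
`x - y ∈ ℓ_p` and `‖x - y‖_{ℓ_p} ≤ δ`. -/
def IsPerturbation (p : ℝ≥0∞) (δ : ℝ) (x y : ℕ × ℕ → ℝ) : Prop :=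
  ∃ ξ : lp (fun _ : ℕ × ℕ => ℝ) p, (∀ i, ξ i = x i - y i) ∧ ‖ξ‖ ≤ δ

/-- The hyperbolic cross `Γ_n = {(k, j) : k j ≤ r n - 1, k, j = r, …, n - 1}`. -/
def hyperbolicCross (r n : ℕ) : Finset (ℕ × ℕ) :=
  (Finset.Ico r n ×ˢ Finset.Ico r n).filter (fun i => i.1 * i.2 < r * n)

/-- The truncation method `D_n^{(r,r)}`, applied to the (perturbed) coefficients `y`. -/
def truncation (r n : ℕ) (y : ℕ × ℕ → ℝ) : L2Q :=
  ∑ i ∈ hyperbolicCross r n, y i • legendreDerivL2 r i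

/-- The order `(δ⁻¹ ln^{1/p-1/s}(1/δ)) ^ (1/(μ-1/p+1/s))` of the discretization parameter `n`
(here and below `1/p = 0` for `p = ∞`). -/
def levelOrder (s μ : ℝ) (p : ℝ≥0∞) (δ : ℝ) : ℝ :=
  (δ⁻¹ * Real.log (1 / δ) ^ (p⁻¹.toReal - 1 / s)) ^ (1 / (μ - p⁻¹.toReal + 1 / s))

/-- The order of accuracy
`(δ ln^{1/s-1/p}(1/δ)) ^ ((μ-2r+1/s-1/2)/(μ-1/p+1/s)) ln^{3/2-1/s}(1/δ)`. -/
def accuracyOrder (r : ℕ) (s μ : ℝ) (p : ℝ≥0∞) (δ : ℝ) : ℝ :=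
  (δ * Real.log (1 / δ) ^ (1 / s - p⁻¹.toReal)) ^
      ((μ - 2 * r + 1 / s - 1 / 2) / (μ - p⁻¹.toReal + 1 / s)) *
    Real.log (1 / δ) ^ (3 / 2 - 1 / s)

/-- The order `(δ⁻¹ ln^μ(1/δ)) ^ (1/(μ-1/p+1/s))` of the number of coefficients. -/
def cardOrder (s μ : ℝ) (p : ℝ≥0∞) (δ : ℝ) : ℝ :=
  (δ⁻¹ * Real.log (1 / δ) ^ μ) ^ (1 / (μ - p⁻¹.toReal + 1 / s))

end MixedDeriv

end

/-! The error splits into a truncation part, carried by the coefficients outside the hyperbolic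
cross, and a noise part, carried by the perturbation on the cross. Both are estimated by the plain
triangle inequality in `L₂(Q)`, with no orthogonality between the differentiated terms.

The analytic input is the bound `‖φ_k^{(r)}‖ ≤ 2 k ^ (2r - 1/2)`
(`polyNorm_iterate_derivative_legendre_le`), so that a product term has norm at most `4 (k j) ^ (2r
- 1/2)`. From then on only `N = k j` matters, together with the count of at most `N (1 + ln N)`
pairs with `k j ≤ N`.

Truncation (`sum_tail_le`): by Hölder, the block `M ≤ k j ≤ 2M` contributes at most a constant times
`M ^ (-κ) (1 + ln (2M)) ^ (1 - 1/s)` with `κ = μ - 2r + 1/s - 1/2 > 0`. The blocks decay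
geometrically, up to a factor linear in the block number, and the tail from `k j ≥ r n` is of order
`n ^ (-κ) ln ^ (1 - 1/s) n`. Noise (`norm_truncation_sub_le`): Hölder in `ℓ_p` on the cross gives
order `δ n ^ (2r - 1/2) (n ln n) ^ (1 - 1/p)`.

For `n` of order `X(δ)` both parts are `O(X ^ (-κ) ln ^ (1 - 1/s) (1/δ))`. This beats the claimed
rate by a factor `ln ^ (1/2) (1/δ)`, which is bounded below when `δ ≤ δ₀ < 1`. The cardinality
claims follow from harmonic sums and from `ln n ≍ ln (1/δ)`. -/

namespace MixedDeriv

/-! ### Legendre polynomials: `L₂` norms of derivatives. -/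

section Legendre

open Polynomial

/-- The Legendre polynomial normalised by the value `1` at the point `1`. -/
noncomputable def legendreP (k : ℕ) : ℝ[X] :=
  C (((2 : ℝ) ^ k * (k.factorial : ℝ))⁻¹) * derivative^[k] ((X ^ 2 - 1) ^ k)

theorem legendre_eq_legendreP (k : ℕ) :
    legendre k = C (Real.sqrt (k + 1 / 2)) * legendreP k := by
  rw [legendre, legendreP, C_mul, mul_assoc]

theorem legendreP_zero : legendreP 0 = 1 := by simp [legendreP]

theorem legendreP_one : legendreP 1 = X := by
  rw [legendreP]
  simp only [pow_one, Nat.factorial_one, Nat.cast_one, mul_one, Function.iterate_one,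
    derivative_sub, derivative_X_sq, derivative_one, sub_zero]
  rw [← mul_assoc, ← C_mul]
  norm_num

theorem two_pow_mul_factorial_succ_inv (k : ℕ) :
    ((2 : ℝ) ^ (k + 1) * ((k + 1).factorial : ℝ))⁻¹ * (2 * (k + 1)) =
      ((2 : ℝ) ^ k * (k.factorial : ℝ))⁻¹ := by
  rw [Nat.factorial_succ]
  push_cast
  have : (k.factorial : ℝ) ≠ 0 := by positivity
  field_simp
  ring

theorem derivative_X_sq_sub_one_pow_succ (k : ℕ) :
    derivative ((X ^ 2 - 1 : ℝ[X]) ^ (k + 1)) =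
      C (2 * ((k : ℝ) + 1)) * (X * (X ^ 2 - 1) ^ k) := by
  rw [derivative_pow_succ]
  simp only [derivative_sub, derivative_X_pow, derivative_one, C_mul, C_add, C_1, map_natCast,
    map_ofNat]
  push_cast
  ring

theorem derivative_derivative_X_sq_sub_one_pow (k : ℕ) :
    derivative (derivative ((X ^ 2 - 1 : ℝ[X]) ^ (k + 2))) =
      C (2 * ((k : ℝ) + 2)) *
        (C (2 * (k : ℝ) + 3) * (X ^ 2 - 1) ^ (k + 1) + C (2 * ((k : ℝ) + 1)) * (X ^ 2 - 1) ^ k) := by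
  rw [derivative_X_sq_sub_one_pow_succ, derivative_C_mul, derivative_mul,
    derivative_X_sq_sub_one_pow_succ]
  simp only [derivative_X, C_mul, C_add, C_1, map_natCast, map_ofNat]
  push_cast
  ring

/-- The second derivative of `(X ^ 2 - 1) ^ (k + 2)`, with `X ^ 2` written as `(X ^ 2 - 1) + 1`,
combines the two preceding powers; `k + 1` further derivatives turn it into this recursion, which
drives the induction for the norm bounds. -/
theorem derivative_legendreP_add_two (k : ℕ) :
    derivative (legendreP (k + 2)) =
      C (2 * (k : ℝ) + 3) * legendreP (k + 1) + derivative (legendreP k) := by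
  have h1 := two_pow_mul_factorial_succ_inv k
  have h2 := two_pow_mul_factorial_succ_inv (k + 1)
  rw [legendreP, derivative_C_mul, ← Function.iterate_succ_apply' derivative (k + 2),
    Function.iterate_succ_apply,
    Function.iterate_succ_apply, derivative_derivative_X_sq_sub_one_pow, iterate_derivative_C_mul,
    iterate_map_add, iterate_derivative_C_mul, iterate_derivative_C_mul, legendreP,
    legendreP, derivative_C_mul, ← h1, ← h2, ← Function.iterate_succ_apply' derivative k]
  push_cast
  rw [show (k : ℝ) + 1 + 1 = k + 2 by ring]
  simp only [C_mul]
  ring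

theorem eval_iterate_derivative_X_sq_sub_one_pow {x : ℝ} (hx : x ^ 2 = 1) {j k : ℕ} (hjk : j < k) :
    (derivative^[j] ((X ^ 2 - 1 : ℝ[X]) ^ k)).eval x = 0 := by
  obtain ⟨q, hq⟩ := pow_sub_dvd_iterate_derivative_pow (X ^ 2 - 1 : ℝ[X]) k j
  rw [hq, eval_mul, eval_pow]
  simp [hx, Nat.sub_ne_zero_of_lt hjk]

theorem eval_legendreP {x : ℝ} (hx : x ^ 2 = 1) (k : ℕ) : (legendreP k).eval x = x ^ k := by
  induction k with
  | zero => simp [legendreP_zero]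
  | succ k ih =>
    have h1 := two_pow_mul_factorial_succ_inv k
    rw [legendreP, eval_mul, eval_C] at ih
    rw [legendreP, Function.iterate_succ_apply, derivative_X_sq_sub_one_pow_succ,
      iterate_derivative_C_mul, ← mul_assoc, ← C_mul, h1, eval_mul, eval_C]
    -- In the Leibniz rule the other term has only `k - 1` derivatives on the `k`-th power, so it
    -- vanishes at `±1`.
    have : (derivative^[k] (X * (X ^ 2 - 1 : ℝ[X]) ^ k)).eval x =
        x * (derivative^[k] ((X ^ 2 - 1 : ℝ[X]) ^ k)).eval x := by
      cases k with
      | zero => simp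
      | succ k =>
        rw [mul_comm X, iterate_derivative_mul_X, eval_add, eval_mul, eval_X, nsmul_eq_mul,
          eval_mul, Nat.add_sub_cancel,
          eval_iterate_derivative_X_sq_sub_one_pow hx (Nat.lt_succ_self k)]
        ring
    rw [this, mul_left_comm, ih]
    ring

theorem abs_eval_derivative_legendreP_le {x : ℝ} (hx : x ^ 2 = 1) (k : ℕ) :
    |(derivative (legendreP k)).eval x| ≤ (k : ℝ) ^ 2 := by
  have hx1 : |x| = 1 := by
    exact (pow_eq_one_iff_of_nonneg (abs_nonneg x) two_ne_zero).1 (by rw [sq_abs, hx])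
  induction k using Nat.twoStepInduction with
  | zero => simp [legendreP_zero]
  | one => simp [legendreP_one]
  | more k ih _ =>
    rw [derivative_legendreP_add_two, eval_add, eval_mul, eval_C, eval_legendreP hx]
    refine (abs_add_le _ _).trans ?_
    rw [abs_mul, abs_pow, hx1, one_pow, mul_one, abs_of_nonneg (by positivity)]
    push_cast
    nlinarith [(Nat.cast_nonneg k : (0 : ℝ) ≤ k)]

theorem natDegree_legendreP_le (k : ℕ) : (legendreP k).natDegree ≤ k := by
  refine (natDegree_C_mul_le _ _).trans ((natDegree_iterate_derivative _ _).trans ?_)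
  have h : ((X ^ 2 - 1 : ℝ[X])).natDegree ≤ 2 := by compute_degree
  have := (natDegree_pow_le (p := (X ^ 2 - 1 : ℝ[X])) (n := k)).trans (Nat.mul_le_mul_left k h)
  omega

theorem integral_mul_derivative (p q : ℝ[X]) :
    ∫ t in (-1 : ℝ)..1, p.eval t * (derivative q).eval t =
      p.eval 1 * q.eval 1 - p.eval (-1) * q.eval (-1) -
        ∫ t in (-1 : ℝ)..1, (derivative p).eval t * q.eval t :=
  intervalIntegral.integral_mul_deriv_eq_deriv_mul (fun x _ => p.hasDerivAt x)
    (fun x _ => q.hasDerivAt x) ((derivative p).continuous.intervalIntegrable _ _)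
    ((derivative q).continuous.intervalIntegrable _ _)

/-- Integration by parts `m` times: every boundary term has fewer than `k` derivatives on the `k`-th
power and vanishes at `±1`. -/
theorem integral_mul_iterate_derivative_eq_zero (k : ℕ) {m : ℕ} (hm : m ≤ k) (q : ℝ[X])
    (hq : derivative^[m] q = 0) :
    ∫ t in (-1 : ℝ)..1, q.eval t * (derivative^[m] ((X ^ 2 - 1 : ℝ[X]) ^ k)).eval t = 0 := by
  induction m generalizing q with
  | zero => simp_all
  | succ m ih =>
    rw [Function.iterate_succ_apply', integral_mul_derivative,
      eval_iterate_derivative_X_sq_sub_one_pow (by norm_num) hm,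
      eval_iterate_derivative_X_sq_sub_one_pow (by norm_num) hm, ih (by omega) _ hq]
    ring

theorem integral_mul_legendreP_eq_zero (k : ℕ) (q : ℝ[X]) (hq : derivative^[k] q = 0) :
    ∫ t in (-1 : ℝ)..1, q.eval t * (legendreP k).eval t = 0 := by
  simp only [legendreP, eval_mul, eval_C]
  simp_rw [mul_left_comm]
  rw [intervalIntegral.integral_const_mul, integral_mul_iterate_derivative_eq_zero k le_rfl q hq,
    mul_zero]

/-- After one integration by parts the remaining integral pairs `P_k` with `P_k''`, of lower degree,
and is zero. The two boundary terms are at most `k ^ 2` each. -/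
theorem integral_sq_derivative_legendreP_le (k : ℕ) :
    ∫ t in (-1 : ℝ)..1, ((derivative (legendreP k)).eval t) ^ 2 ≤ 2 * (k : ℝ) ^ 2 := by
  simp_rw [sq ((derivative (legendreP k)).eval _)]
  rw [integral_mul_derivative, integral_mul_legendreP_eq_zero]
  · rw [eval_legendreP (by norm_num), eval_legendreP (by norm_num)]
    have h1 := abs_eval_derivative_legendreP_le (x := 1) (by norm_num) k
    have h2 := abs_eval_derivative_legendreP_le (x := -1) (by norm_num) k
    have h3 : |(derivative (legendreP k)).eval (-1) * (-1) ^ k| ≤ (k : ℝ) ^ 2 := by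
      rw [abs_mul, abs_pow]
      simpa using h2
    have h4 := neg_abs_le ((derivative (legendreP k)).eval (-1) * (-1) ^ k)
    have h5 := le_abs_self ((derivative (legendreP k)).eval 1)
    rw [one_pow]
    linarith
  · rw [← Function.iterate_succ_apply derivative, ← Function.iterate_succ_apply derivative]
    exact iterate_derivative_eq_zero ((natDegree_legendreP_le k).trans_lt (by omega))

/-- The norm of a polynomial in `L₂(-1, 1)`. -/
noncomputable def polyNorm (q : ℝ[X]) : ℝ :=
  (eLpNorm (fun t => q.eval t) 2 (volume.restrict (Icc (-1 : ℝ) 1))).toReal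

theorem memLp_eval (q : ℝ[X]) :
    MemLp (fun t => q.eval t) 2 (volume.restrict (Icc (-1 : ℝ) 1)) := by
  obtain ⟨M, hM⟩ := isCompact_Icc.exists_bound_of_continuousOn (s := Icc (-1 : ℝ) 1)
    q.continuous.continuousOn
  refine MemLp.of_bound q.continuous.aestronglyMeasurable M ?_
  exact (ae_restrict_iff' measurableSet_Icc).2 (Filter.Eventually.of_forall hM)

theorem toReal_eLpNorm_two_sq {α : Type*} [MeasurableSpace α] {ν : Measure α} {f : α → ℝ}
    (hf : MemLp f 2 ν) : (eLpNorm f 2 ν).toReal ^ 2 = ∫ x, f x ^ 2 ∂ν := by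
  have h0 : 0 ≤ ∫ x, f x ^ 2 ∂ν := integral_nonneg fun x => sq_nonneg _
  rw [hf.eLpNorm_eq_integral_rpow_norm (by norm_num) (by norm_num)]
  simp only [ENNReal.toReal_ofNat, Real.norm_eq_abs, Real.rpow_ofNat, sq_abs]
  rw [ENNReal.toReal_ofReal (by positivity), ← Real.rpow_natCast, ← Real.rpow_mul h0]
  norm_num

theorem polyNorm_nonneg (q : ℝ[X]) : 0 ≤ polyNorm q := ENNReal.toReal_nonneg

theorem polyNorm_add_le (p q : ℝ[X]) : polyNorm (p + q) ≤ polyNorm p + polyNorm q := by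
  unfold polyNorm
  rw [← ENNReal.toReal_add (memLp_eval p).eLpNorm_ne_top (memLp_eval q).eLpNorm_ne_top]
  refine ENNReal.toReal_mono (ENNReal.add_ne_top.2
    ⟨(memLp_eval p).eLpNorm_ne_top, (memLp_eval q).eLpNorm_ne_top⟩) ?_
  simp only [eval_add]
  exact eLpNorm_add_le (memLp_eval p).1 (memLp_eval q).1 (by norm_num)

theorem polyNorm_sq (q : ℝ[X]) : polyNorm q ^ 2 = ∫ t in (-1 : ℝ)..1, (q.eval t) ^ 2 := by
  rw [polyNorm, toReal_eLpNorm_two_sq (memLp_eval q), intervalIntegral.integral_of_le (by norm_num),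
    integral_Icc_eq_integral_Ioc]

theorem polyNorm_C_mul {c : ℝ} (hc : 0 ≤ c) (q : ℝ[X]) : polyNorm (C c * q) = c * polyNorm q := by
  rw [← sq_eq_sq₀ (polyNorm_nonneg _) (mul_nonneg hc (polyNorm_nonneg _)), mul_pow, polyNorm_sq,
    polyNorm_sq]
  simp only [eval_mul, eval_C, mul_pow]
  rw [intervalIntegral.integral_const_mul]

theorem polyNorm_zero : polyNorm 0 = 0 := by simp [polyNorm]

/-- Differentiating the recursion for `P_{k+2}'` bounds order `r + 2` by order `r + 1` at `k + 1`
and order `r + 2` at `k`: hence induction on `r` and, inside it, two-step induction on `k`. -/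
theorem polyNorm_iterate_derivative_legendreP_le (r k : ℕ) :
    polyNorm (derivative^[r + 1] (legendreP k)) ≤ Real.sqrt 2 * (k : ℝ) ^ (2 * r + 1) := by
  induction r generalizing k with
  | zero =>
    refine le_of_sq_le_sq ?_ (by positivity)
    rw [polyNorm_sq, mul_pow, Real.sq_sqrt (by norm_num)]
    simpa using integral_sq_derivative_legendreP_le k
  | succ r ihr =>
    induction k using Nat.twoStepInduction with
    | zero => simp [legendreP_zero, polyNorm_zero]
    | one =>
      simp [legendreP_one, polyNorm_zero]
    | more k ih _ =>
      have e : derivative^[r + 1 + 1] (legendreP (k + 2)) =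
          C (2 * (k : ℝ) + 3) * derivative^[r + 1] (legendreP (k + 1)) +
            derivative^[r + 1 + 1] (legendreP k) := by
        rw [Function.iterate_succ_apply, derivative_legendreP_add_two, iterate_map_add,
          iterate_derivative_C_mul, ← Function.iterate_succ_apply derivative]
      rw [e]
      refine (polyNorm_add_le _ _).trans ?_
      rw [polyNorm_C_mul (by positivity)]
      have h1 := mul_le_mul_of_nonneg_left (ihr (k + 1)) (by positivity : 0 ≤ 2 * (k : ℝ) + 3)
      refine (add_le_add h1 ih).trans ?_
      push_cast
      have hk : (0 : ℝ) ≤ k := Nat.cast_nonneg k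
      have h2 : ((k : ℝ) + 1) ^ (2 * r + 1) ≤ ((k : ℝ) + 2) ^ (2 * r + 1) := by gcongr; norm_num
      have h3 : (k : ℝ) ^ (2 * (r + 1)) ≤ ((k : ℝ) + 2) ^ (2 * (r + 1)) := by gcongr; linarith
      have h4 : (2 * (k : ℝ) + 3) * ((k : ℝ) + 1) ^ (2 * r + 1) ≤
          2 * ((k : ℝ) + 2) ^ (2 * (r + 1)) := by
        rw [show 2 * (r + 1) = (2 * r + 1) + 1 by ring, pow_succ ((k : ℝ) + 2)]
        have : 0 ≤ ((k : ℝ) + 2) ^ (2 * r + 1) := by positivity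
        nlinarith
      -- With `A = (k + 2) ^ (2r + 2)` the summands are at most `2 A` and `k A`, so the constant
      -- does not grow with `k`.
      have h5 : (2 * (k : ℝ) + 3) * ((k : ℝ) + 1) ^ (2 * r + 1) + (k : ℝ) ^ (2 * (r + 1) + 1) ≤
          ((k : ℝ) + 2) ^ (2 * (r + 1) + 1) := by
        rw [pow_succ (k : ℝ), pow_succ ((k : ℝ) + 2)]
        nlinarith
      have := mul_le_mul_of_nonneg_left h5 (Real.sqrt_nonneg 2)
      linarith

theorem polyNorm_iterate_derivative_legendre_le {r k : ℕ} (hr : 1 ≤ r) (hk : 1 ≤ k) :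
    polyNorm (derivative^[r] (legendre k)) ≤ 2 * (k : ℝ) ^ (2 * (r : ℝ) - 1 / 2) := by
  obtain ⟨r, rfl⟩ := Nat.exists_eq_add_of_le' hr
  have hk1 : (1 : ℝ) ≤ k := by exact_mod_cast hk
  rw [legendre_eq_legendreP, iterate_derivative_C_mul, polyNorm_C_mul (Real.sqrt_nonneg _)]
  refine (mul_le_mul_of_nonneg_left (polyNorm_iterate_derivative_legendreP_le r k)
    (Real.sqrt_nonneg _)).trans ?_
  have h1 : Real.sqrt (k + 1 / 2) * Real.sqrt 2 ≤ 2 * Real.sqrt k := by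
    rw [← Real.sqrt_mul (by positivity)]
    refine Real.sqrt_le_iff.2 ⟨by positivity, ?_⟩
    rw [mul_pow, Real.sq_sqrt (by positivity)]
    linarith
  have h2 : (k : ℝ) ^ (2 * ((r + 1 : ℕ) : ℝ) - 1 / 2) = Real.sqrt k * (k : ℝ) ^ (2 * r + 1) := by
    rw [Real.sqrt_eq_rpow, ← Real.rpow_natCast, ← Real.rpow_add (by positivity)]
    congr 1
    push_cast
    ring
  rw [h2, ← mul_assoc, ← mul_assoc]
  gcongr

theorem norm_legendreDerivL2 (r : ℕ) (i : ℕ × ℕ) :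
    ‖legendreDerivL2 r i‖ =
      polyNorm (derivative^[r] (legendre i.1)) * polyNorm (derivative^[r] (legendre i.2)) := by
  rw [← sq_eq_sq₀ (norm_nonneg _) (mul_nonneg (polyNorm_nonneg _) (polyNorm_nonneg _)),
    legendreDerivL2, Lp.norm_toLp, toReal_eLpNorm_two_sq (memLp_legendreDeriv r i), mul_pow,
    polyNorm, polyNorm, toReal_eLpNorm_two_sq (memLp_eval _), toReal_eLpNorm_two_sq (memLp_eval _)]
  simp only [legendreDeriv, mul_pow, Q, Measure.volume_eq_prod]
  exact setIntegral_prod_mul (fun t => ((derivative^[r] (legendre i.1)).eval t) ^ 2)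
    (fun t => ((derivative^[r] (legendre i.2)).eval t) ^ 2) _ _

theorem norm_legendreDerivL2_le {r : ℕ} (hr : 1 ≤ r) {i : ℕ × ℕ} (h1 : 1 ≤ i.1) (h2 : 1 ≤ i.2) :
    ‖legendreDerivL2 r i‖ ≤ 4 * ((i.1 * i.2 : ℕ) : ℝ) ^ (2 * (r : ℝ) - 1 / 2) := by
  rw [norm_legendreDerivL2, Nat.cast_mul, Real.mul_rpow (by positivity) (by positivity)]
  refine (mul_le_mul (polyNorm_iterate_derivative_legendre_le hr h1)
    (polyNorm_iterate_derivative_legendre_le hr h2) (polyNorm_nonneg _) (by positivity)).trans ?_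
  apply le_of_eq
  ring

end Legendre

/-! ### Counting lattice points under a hyperbola, and dyadic tail sums. -/

theorem card_le_mul_one_add_log {N : ℕ} (F : Finset (ℕ × ℕ))
    (hF : ∀ i ∈ F, 1 ≤ i.1 ∧ 1 ≤ i.2 ∧ i.1 * i.2 ≤ N) :
    (F.card : ℝ) ≤ N * (1 + Real.log N) := by
  have h1 : F.card ≤ ∑ k ∈ Finset.Icc 1 N, N / k := by
    rw [Finset.card_eq_sum_card_fiberwise (f := Prod.fst) (t := Finset.Icc 1 N)]
    · refine Finset.sum_le_sum fun k hk => ?_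
      rw [show N / k = (Finset.Icc 1 (N / k)).card by simp]
      refine Finset.card_le_card_of_injOn Prod.snd ?_ ?_
      · intro i hi
        simp only [Finset.mem_coe, Finset.mem_filter] at hi
        obtain ⟨hi, rfl⟩ := hi
        obtain ⟨h1, h2, h3⟩ := hF i hi
        simp only [Finset.coe_Icc, mem_Icc]
        exact ⟨h2, (Nat.le_div_iff_mul_le h1).2 (by rwa [mul_comm])⟩
      · intro i hi j hj hij
        simp only [Finset.mem_coe, Finset.mem_filter] at hi hj
        exact Prod.ext (hi.2.trans hj.2.symm) hij
    · intro i hi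
      obtain ⟨h1, h2, h3⟩ := hF i hi
      simp only [Finset.coe_Icc, mem_Icc]
      exact ⟨h1, (Nat.le_mul_of_pos_right _ h2).trans h3⟩
  have h2 := harmonic_le_one_add_log N
  rw [harmonic_eq_sum_Icc] at h2
  push_cast at h2
  calc (F.card : ℝ) ≤ ((∑ k ∈ Finset.Icc 1 N, N / k : ℕ) : ℝ) := by exact_mod_cast h1
    _ ≤ ∑ k ∈ Finset.Icc 1 N, (N : ℝ) * (k : ℝ)⁻¹ := by
        push_cast
        exact Finset.sum_le_sum fun k _ => Nat.cast_div_le.trans_eq (div_eq_mul_inv _ _)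
    _ = N * ∑ k ∈ Finset.Icc 1 N, (k : ℝ)⁻¹ := by rw [Finset.mul_sum]
    _ ≤ _ := by gcongr

theorem sum_abs_le_card_rpow_mul {ι : Type*} (F : Finset ι) (a : ι → ℝ) {s T : ℝ} (hs : 1 ≤ s)
    (hT : 0 ≤ T) (h : ∑ i ∈ F, |a i| ^ s ≤ T ^ s) :
    ∑ i ∈ F, |a i| ≤ (F.card : ℝ) ^ (1 - 1 / s) * T := by
  have hs0 : 0 < s := by linarith
  have h1 := Real.rpow_sum_le_const_mul_sum_rpow F a hs
  rw [← Real.rpow_le_rpow_iff (Finset.sum_nonneg fun i _ => abs_nonneg _) (by positivity) hs0,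
    Real.mul_rpow (by positivity) hT, ← Real.rpow_mul (by positivity)]
  have e : (1 - 1 / s) * s = s - 1 := by field_simp
  rw [e]
  exact h1.trans (by gcongr)

/-- A weighted sum over pairs on a dyadic block `M ≤ k j ≤ 2 M`. -/
theorem sum_block_le {s μ b : ℝ} (hs : 1 ≤ s) (hb : b ≤ μ) (a : ℕ × ℕ → ℝ) {M : ℕ} (hM : 1 ≤ M)
    (F : Finset (ℕ × ℕ)) (hF : ∀ i ∈ F, 1 ≤ i.1 ∧ 1 ≤ i.2 ∧ M ≤ i.1 * i.2 ∧ i.1 * i.2 ≤ 2 * M)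
    (ha : ∑ i ∈ F, ((i.1 * i.2 : ℕ) : ℝ) ^ (s * μ) * |a i| ^ s ≤ 1) :
    ∑ i ∈ F, |a i| * ((i.1 * i.2 : ℕ) : ℝ) ^ b ≤
      (M : ℝ) ^ (b - μ) * ((2 * M : ℕ) * (1 + Real.log (2 * M : ℕ))) ^ (1 - 1 / s) := by
  have hM0 : (0 : ℝ) < M := by exact_mod_cast hM
  have hs1 : 0 ≤ 1 - 1 / s := by
    rw [sub_nonneg, div_le_one (by linarith)]
    exact hs
  have h1 := sum_abs_le_card_rpow_mul F (fun i => ((i.1 * i.2 : ℕ) : ℝ) ^ μ * |a i|) hs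
    zero_le_one (by
      rw [Real.one_rpow]
      refine le_trans (Finset.sum_le_sum fun i _ => ?_) ha
      rw [abs_of_nonneg (by positivity), Real.mul_rpow (by positivity) (abs_nonneg _),
        ← Real.rpow_mul (by positivity), mul_comm s])
  have h2 := card_le_mul_one_add_log (N := 2 * M) F
    fun i hi => ⟨(hF i hi).1, (hF i hi).2.1, (hF i hi).2.2.2⟩
  calc ∑ i ∈ F, |a i| * ((i.1 * i.2 : ℕ) : ℝ) ^ b
      ≤ ∑ i ∈ F, (M : ℝ) ^ (b - μ) * |(((i.1 * i.2 : ℕ) : ℝ) ^ μ * |a i|)| := by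
        refine Finset.sum_le_sum fun i hi => ?_
        have hMi : (M : ℝ) ≤ ((i.1 * i.2 : ℕ) : ℝ) := by exact_mod_cast (hF i hi).2.2.1
        have hi0 : (0 : ℝ) < ((i.1 * i.2 : ℕ) : ℝ) := hM0.trans_le hMi
        rw [abs_of_nonneg (by positivity : 0 ≤ ((i.1 * i.2 : ℕ) : ℝ) ^ μ * |a i|), ← mul_assoc,
          mul_comm |a i|]
        refine mul_le_mul_of_nonneg_right ?_ (abs_nonneg _)
        have e : ((i.1 * i.2 : ℕ) : ℝ) ^ b =
            ((i.1 * i.2 : ℕ) : ℝ) ^ (b - μ) * ((i.1 * i.2 : ℕ) : ℝ) ^ μ := by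
          rw [← Real.rpow_add hi0, sub_add_cancel]
        rw [e]
        exact mul_le_mul_of_nonneg_right
          (Real.rpow_le_rpow_of_nonpos hM0 hMi (by linarith)) (by positivity)
    _ = (M : ℝ) ^ (b - μ) * ∑ i ∈ F, |(((i.1 * i.2 : ℕ) : ℝ) ^ μ * |a i|)| := by
        rw [Finset.mul_sum]
    _ ≤ _ := by
        refine mul_le_mul_of_nonneg_left (h1.trans ?_) (by positivity)
        rw [mul_one]
        exact Real.rpow_le_rpow (by positivity) h2 hs1

theorem summable_dyadic_factor {κ : ℝ} (hκ : 0 < κ) :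
    Summable fun m : ℕ => 2 * ((m : ℝ) + 2) * ((2 : ℝ) ^ (-κ)) ^ m := by
  have h : ‖(2 : ℝ) ^ (-κ)‖ < 1 := by
    rw [Real.norm_of_nonneg (by positivity)]
    exact Real.rpow_lt_one_of_one_lt_of_neg (by norm_num) (by linarith)
  have h1 := summable_pow_mul_geometric_of_norm_lt_one 1 h
  have h0 := summable_geometric_of_norm_lt_one h
  refine ((h1.add (h0.mul_left 2)).mul_left 2).congr fun m => ?_
  simp only [pow_one]
  ring

/-- The constant in the tail estimate `sum_tail_le`. -/
noncomputable def tailConst (κ : ℝ) : ℝ := ∑' m : ℕ, 2 * ((m : ℝ) + 2) * ((2 : ℝ) ^ (-κ)) ^ m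

theorem tailConst_nonneg (κ : ℝ) : 0 ≤ tailConst κ := tsum_nonneg fun m => by positivity

theorem sum_tail_le {s μ b : ℝ} (hs : 1 ≤ s) (hκ : 0 < μ - b - (1 - 1 / s)) (a : ℕ × ℕ → ℝ)
    {N : ℕ} (hN : 1 ≤ N) (F : Finset (ℕ × ℕ))
    (hF : ∀ i ∈ F, 1 ≤ i.1 ∧ 1 ≤ i.2 ∧ N ≤ i.1 * i.2)
    (ha : ∑ i ∈ F, ((i.1 * i.2 : ℕ) : ℝ) ^ (s * μ) * |a i| ^ s ≤ 1) :
    ∑ i ∈ F, |a i| * ((i.1 * i.2 : ℕ) : ℝ) ^ b ≤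
      tailConst (μ - b - (1 - 1 / s)) *
        ((N : ℝ) ^ (-(μ - b - (1 - 1 / s))) * (1 + Real.log N) ^ (1 - 1 / s)) := by
  have hs1 : 0 ≤ 1 - 1 / s := by
    rw [sub_nonneg, div_le_one (by linarith)]
    exact hs
  have hs2 : 1 - 1 / s ≤ 1 := by
    have : 0 < 1 / s := by positivity
    linarith
  set κ := μ - b - (1 - 1 / s) with hκd
  have hN1 : (1 : ℝ) ≤ N := by exact_mod_cast hN
  have hlog : 0 ≤ Real.log N := Real.log_nonneg hN1
  -- The block number: `g i = m` forces `2 ^ m N ≤ k j ≤ 2 ^ (m + 1) N`.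
  let g : ℕ × ℕ → ℕ := fun i => Nat.log 2 (i.1 * i.2 / N)
  rw [← Finset.sum_fiberwise_of_maps_to (t := F.image g) (g := g)
    (fun i hi => Finset.mem_image_of_mem g hi)]
  have hblock : ∀ m ∈ F.image g,
      ∑ i ∈ F with g i = m, |a i| * ((i.1 * i.2 : ℕ) : ℝ) ^ b ≤
        2 * ((m : ℝ) + 2) * ((2 : ℝ) ^ (-κ)) ^ m *
          ((N : ℝ) ^ (-κ) * (1 + Real.log N) ^ (1 - 1 / s)) := by
    intro m _
    have hM : 1 ≤ 2 ^ m * N := Nat.mul_pos (by positivity) hN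
    refine (sum_block_le (μ := μ) hs (by linarith) a hM _ ?_ ?_).trans ?_
    · intro i hi
      rw [Finset.mem_filter] at hi
      obtain ⟨h1, h2, h3⟩ := hF i hi.1
      have hq : i.1 * i.2 / N ≠ 0 := (Nat.div_pos h3 hN).ne'
      have h4 := Nat.pow_log_le_self 2 hq
      have h5 := Nat.lt_pow_succ_log_self (b := 2) one_lt_two (i.1 * i.2 / N)
      rw [show Nat.log 2 (i.1 * i.2 / N) = m from hi.2] at h4 h5
      refine ⟨h1, h2, (Nat.le_div_iff_mul_le hN).1 h4, ?_⟩
      have h6 := ((Nat.div_lt_iff_lt_mul hN).1 h5).le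
      rw [pow_succ] at h6
      linarith
    · exact le_trans (Finset.sum_le_sum_of_subset_of_nonneg (Finset.filter_subset _ _)
        fun i _ _ => by positivity) ha
    · have hlog2 : Real.log 2 ≤ 1 := by linarith [Real.log_two_lt_d9]
      have hl : 1 + Real.log ((2 * (2 ^ m * N) : ℕ) : ℝ) ≤ ((m : ℝ) + 2) * (1 + Real.log N) := by
        push_cast
        rw [Real.log_mul (by positivity) (by positivity),
          Real.log_mul (by positivity) (by positivity), Real.log_pow]
        have : (0 : ℝ) ≤ m := Nat.cast_nonneg m
        nlinarith [mul_nonneg this hlog, mul_le_mul_of_nonneg_left hlog2 this]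
      have hl0 : 0 ≤ Real.log ((2 * (2 ^ m * N) : ℕ) : ℝ) := Real.log_natCast_nonneg _
      have hMpos : (0 : ℝ) < ((2 ^ m * N : ℕ) : ℝ) := by exact_mod_cast hM
      have hc : (((2 ^ m * N : ℕ) : ℝ)) ^ (b - μ) *
          (((2 ^ m * N : ℕ) : ℝ)) ^ (1 - 1 / s) = ((2 : ℝ) ^ (-κ)) ^ m * (N : ℝ) ^ (-κ) := by
        rw [← Real.rpow_add hMpos, show b - μ + (1 - 1 / s) = -κ by rw [hκd]; ring]
        push_cast
        rw [Real.mul_rpow (by positivity) (by positivity), ← Real.rpow_natCast,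
          ← Real.rpow_natCast, ← Real.rpow_mul (by norm_num), ← Real.rpow_mul (by norm_num),
          mul_comm (m : ℝ)]
      -- The exponent `1 - 1 / s` is dropped from `2` and `m + 2` so that the constant depends on
      -- `κ` alone; it must stay on the factor in `N`.
      have hx : ∀ x : ℝ, 1 ≤ x → x ^ (1 - 1 / s) ≤ x := fun x hx => by
        simpa using Real.rpow_le_rpow_of_exponent_le hx hs2
      have hm2 : (1 : ℝ) ≤ (m : ℝ) + 2 := by
        have : (0 : ℝ) ≤ m := Nat.cast_nonneg m
        linarith
      calc ((2 ^ m * N : ℕ) : ℝ) ^ (b - μ) * (((2 * (2 ^ m * N) : ℕ) : ℝ) *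
            (1 + Real.log ((2 * (2 ^ m * N) : ℕ) : ℝ))) ^ (1 - 1 / s)
          ≤ ((2 ^ m * N : ℕ) : ℝ) ^ (b - μ) * (((2 * (2 ^ m * N) : ℕ) : ℝ) *
            (((m : ℝ) + 2) * (1 + Real.log N))) ^ (1 - 1 / s) := by
            gcongr
        _ = (((2 ^ m * N : ℕ) : ℝ) ^ (b - μ) * ((2 ^ m * N : ℕ) : ℝ) ^ (1 - 1 / s)) *
            ((2 : ℝ) ^ (1 - 1 / s) * ((m : ℝ) + 2) ^ (1 - 1 / s) *
              (1 + Real.log N) ^ (1 - 1 / s)) := by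
            rw [Nat.cast_mul 2, Real.mul_rpow (by positivity) (by positivity),
              Real.mul_rpow (by positivity) (by positivity),
              Real.mul_rpow (by positivity) (by positivity)]
            push_cast
            ring
        _ ≤ (((2 : ℝ) ^ (-κ)) ^ m * (N : ℝ) ^ (-κ)) *
            (2 * ((m : ℝ) + 2) * (1 + Real.log N) ^ (1 - 1 / s)) := by
            rw [hc]
            gcongr
            · exact hx 2 (by norm_num)
            · exact hx _ hm2
        _ = _ := by ring
  refine (Finset.sum_le_sum hblock).trans ?_
  rw [← Finset.sum_mul]
  exact mul_le_mul_of_nonneg_right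
    ((summable_dyadic_factor hκ).sum_le_tsum _ fun m _ => by positivity) (by positivity)

theorem sum_abs_le_of_mem_lp {p : ℝ≥0∞} (hp : 1 ≤ p) (ξ : lp (fun _ : ℕ × ℕ => ℝ) p)
    (F : Finset (ℕ × ℕ)) :
    ∑ i ∈ F, |ξ i| ≤ (F.card : ℝ) ^ (1 - p⁻¹.toReal) * ‖ξ‖ := by
  rcases eq_or_ne p ⊤ with rfl | hpt
  · have h : ∀ i ∈ F, |ξ i| ≤ ‖ξ‖ := fun i _ => lp.norm_apply_le_norm (by simp) ξ i
    refine (Finset.sum_le_card_nsmul _ _ _ h).trans_eq ?_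
    simp
  · have hp1 : 1 ≤ p.toReal := by
      simpa using ENNReal.toReal_mono hpt hp
    rw [ENNReal.toReal_inv, ← one_div]
    exact sum_abs_le_card_rpow_mul F (fun i => ξ i) hp1 (lp.norm_nonneg' ξ)
      (lp.sum_rpow_le_norm_rpow (by linarith) ξ F)

/-! ### The hyperbolic cross and its cardinality. -/

/-- The constraints `k, j < n` are redundant: an index at least `n` times one at least `r` is
already at least `r n`. -/
theorem mem_hyperbolicCross {r n : ℕ} {i : ℕ × ℕ} :
    i ∈ hyperbolicCross r n ↔ r ≤ i.1 ∧ r ≤ i.2 ∧ i.1 * i.2 < r * n := by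
  simp only [hyperbolicCross, Finset.mem_filter, Finset.mem_product, Finset.mem_Ico]
  constructor
  · tauto
  · rintro ⟨h1, h2, h3⟩
    refine ⟨⟨⟨h1, ?_⟩, h2, ?_⟩, h3⟩
    · by_contra! h
      have := Nat.mul_le_mul h h2
      rw [mul_comm n] at this
      omega
    · by_contra! h
      have := Nat.mul_le_mul h1 h
      omega

theorem card_hyperbolicCross_le {r n : ℕ} (hr : 1 ≤ r) :
    ((hyperbolicCross r n).card : ℝ) ≤ (r * n : ℕ) * (1 + Real.log (r * n : ℕ)) :=
  card_le_mul_one_add_log _ fun i hi => by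
    rw [mem_hyperbolicCross] at hi
    exact ⟨hr.trans hi.1, hr.trans hi.2.1, hi.2.2.le⟩

/-- The column over `k` contains at least `r n / k - r` points; the harmonic sum over `r ≤ k < n` is
at least `ln n - r`. -/
theorem le_card_hyperbolicCross {r n : ℕ} (hr : 1 ≤ r) (hn : 1 ≤ n) :
    r * n * (Real.log n - r - 1) ≤ ((hyperbolicCross r n).card : ℝ) := by
  have hr0 : (0 : ℝ) < r := by exact_mod_cast hr
  have hn0 : (0 : ℝ) < n := by exact_mod_cast hn
  have h1 : ∑ k ∈ Finset.Ico r n, ((r : ℝ) * n / k - r) ≤ ((hyperbolicCross r n).card : ℝ) := by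
    rw [Finset.card_eq_sum_card_fiberwise (f := Prod.fst) (t := Finset.Ico r n), Nat.cast_sum]
    · refine Finset.sum_le_sum fun k hk => ?_
      rw [Finset.mem_Ico] at hk
      have hk0 : 0 < k := by omega
      have hkR : (0 : ℝ) < k := by exact_mod_cast hk0
      -- The ceiling of `r n / k`, so that `j < m` gives `k j < r n`.
      let m := (r * n + k - 1) / k
      have hsub : (Finset.Ico r m).card ≤
          ((hyperbolicCross r n).filter fun i => i.1 = k).card := by
        refine Finset.card_le_card_of_injOn (fun j => (k, j)) ?_ ?_
        · intro j hj
          simp only [Finset.coe_Ico, mem_Ico] at hj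
          have h := (Nat.le_div_iff_mul_le hk0).1 (show j + 1 ≤ m from hj.2)
          simp only [Finset.mem_coe, Finset.mem_filter, mem_hyperbolicCross, and_true]
          refine ⟨hk.1, hj.1, ?_⟩
          have e : (j + 1) * k = k * j + k := by ring
          omega
        · intro i _ j _ hij
          exact (Prod.ext_iff.1 hij).2
      have hm : r * n ≤ m * k := by
        have h := Nat.lt_div_mul_add (a := r * n + k - 1) hk0
        change r * n + k - 1 < m * k + k at h
        omega
      have hmR : (r : ℝ) * n / k ≤ m := by
        rw [div_le_iff₀ hkR]
        exact_mod_cast hm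
      have hc : (m : ℝ) ≤ (Finset.Ico r m).card + r := by
        rw [Nat.card_Ico]
        exact_mod_cast (by omega : m ≤ m - r + r)
      have : ((Finset.Ico r m).card : ℝ) ≤
          (((hyperbolicCross r n).filter fun i => i.1 = k).card : ℝ) := by exact_mod_cast hsub
      linarith
    · intro i hi
      simp only [hyperbolicCross, Finset.mem_coe, Finset.mem_filter, Finset.mem_product] at hi
      exact hi.1.1
  have h2 : Real.log n ≤ r + ∑ k ∈ Finset.Ico r n, (k : ℝ)⁻¹ := by
    have h := log_add_one_le_harmonic (n - 1)
    rw [harmonic_eq_sum_Icc, Nat.sub_add_cancel hn] at h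
    push_cast at h
    refine h.trans ?_
    have hsub : Finset.Icc 1 (n - 1) ⊆ Finset.Icc 1 r ∪ Finset.Ico r n := by
      intro k hk
      simp only [Finset.mem_Icc, Finset.mem_union, Finset.mem_Ico] at hk ⊢
      omega
    refine (Finset.sum_le_sum_of_subset_of_nonneg hsub fun k _ _ => by positivity).trans ?_
    have hu := Finset.sum_union_inter (s₁ := Finset.Icc 1 r) (s₂ := Finset.Ico r n)
      (f := fun k : ℕ => (k : ℝ)⁻¹)
    have hi : 0 ≤ ∑ k ∈ Finset.Icc 1 r ∩ Finset.Ico r n, (k : ℝ)⁻¹ :=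
      Finset.sum_nonneg fun k _ => by positivity
    have hh : ∑ k ∈ Finset.Icc 1 r, (k : ℝ)⁻¹ ≤ r := by
      refine (Finset.sum_le_card_nsmul _ _ 1 fun k hk => ?_).trans_eq (by simp)
      exact inv_le_one_of_one_le₀ (by exact_mod_cast (Finset.mem_Icc.1 hk).1)
    linarith
  have h3 : ∑ k ∈ Finset.Ico r n, ((r : ℝ) * n / k - r) =
      r * n * ∑ k ∈ Finset.Ico r n, (k : ℝ)⁻¹ - (n - r : ℕ) * r := by
    rw [Finset.sum_sub_distrib, Finset.mul_sum]
    simp [div_eq_mul_inv]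
  have h4 : ((n - r : ℕ) : ℝ) ≤ n := by exact_mod_cast Nat.sub_le n r
  rw [h3] at h1
  have h5 := mul_le_mul_of_nonneg_left h2 (mul_pos hr0 hn0).le
  nlinarith

/-! ### Relations between `X(δ)`, the stated orders and `ln (1/δ)`. -/

theorem log_one_div_pos {δ : ℝ} (h0 : 0 < δ) (h1 : δ < 1) : 0 < Real.log (1 / δ) :=
  Real.log_pos (by rwa [lt_div_iff₀ h0, one_mul])

theorem levelOrder_pos {s μ : ℝ} {p : ℝ≥0∞} {δ : ℝ} (h0 : 0 < δ) (h1 : δ < 1) :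
    0 < levelOrder s μ p δ := by
  have := log_one_div_pos h0 h1
  unfold levelOrder
  positivity

theorem log_levelOrder {s μ : ℝ} {p : ℝ≥0∞} {δ : ℝ} (h0 : 0 < δ) (h1 : δ < 1) :
    Real.log (levelOrder s μ p δ) = 1 / (μ - p⁻¹.toReal + 1 / s) *
      (Real.log (1 / δ) + (p⁻¹.toReal - 1 / s) * Real.log (Real.log (1 / δ))) := by
  have h := log_one_div_pos h0 h1
  rw [levelOrder, Real.log_rpow (by positivity), Real.log_mul (by positivity) (by positivity),
    Real.log_rpow h, one_div δ]

theorem levelOrder_rpow {s μ : ℝ} {p : ℝ≥0∞} {δ : ℝ} (h0 : 0 < δ) (h1 : δ < 1)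
    (hβ : 0 < μ - p⁻¹.toReal + 1 / s) :
    levelOrder s μ p δ ^ (μ - p⁻¹.toReal + 1 / s) =
      δ⁻¹ * Real.log (1 / δ) ^ (p⁻¹.toReal - 1 / s) := by
  have h := log_one_div_pos h0 h1
  rw [levelOrder, ← Real.rpow_mul (by positivity), one_div_mul_cancel hβ.ne', Real.rpow_one]

theorem accuracyOrder_eq {r : ℕ} {s μ : ℝ} {p : ℝ≥0∞} {δ : ℝ} (h0 : 0 < δ) (h1 : δ < 1) :
    accuracyOrder r s μ p δ = levelOrder s μ p δ ^ (-(μ - 2 * r + 1 / s - 1 / 2)) *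
      Real.log (1 / δ) ^ (3 / 2 - 1 / s) := by
  have h := log_one_div_pos h0 h1
  have e : δ * Real.log (1 / δ) ^ (1 / s - p⁻¹.toReal) =
      (δ⁻¹ * Real.log (1 / δ) ^ (p⁻¹.toReal - 1 / s))⁻¹ := by
    rw [mul_inv, inv_inv, ← Real.rpow_neg h.le, neg_sub]
  rw [accuracyOrder, levelOrder, e, ← Real.rpow_mul (by positivity), ← Real.rpow_neg_one,
    ← Real.rpow_mul (by positivity)]
  congr 2
  ring

theorem cardOrder_eq {s μ : ℝ} {p : ℝ≥0∞} {δ : ℝ} (h0 : 0 < δ) (h1 : δ < 1)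
    (hβ : 0 < μ - p⁻¹.toReal + 1 / s) :
    cardOrder s μ p δ = levelOrder s μ p δ * Real.log (1 / δ) := by
  have h := log_one_div_pos h0 h1
  have e : Real.log (1 / δ) ^ μ = Real.log (1 / δ) ^ (p⁻¹.toReal - 1 / s) *
      Real.log (1 / δ) ^ (μ - p⁻¹.toReal + 1 / s) := by
    rw [← Real.rpow_add h]
    congr 1
    ring
  rw [cardOrder, levelOrder, e, ← mul_assoc, Real.mul_rpow (by positivity) (by positivity),
    ← Real.rpow_mul h.le, mul_one_div_cancel hβ.ne', Real.rpow_one]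

theorem abs_inv_toReal_sub_le {s : ℝ} (hs : 1 ≤ s) {p : ℝ≥0∞} (hp : 1 ≤ p) :
    0 ≤ p⁻¹.toReal ∧ p⁻¹.toReal ≤ 1 ∧ 0 < 1 / s ∧ 1 / s ≤ 1 ∧ |p⁻¹.toReal - 1 / s| ≤ 1 := by
  have h1 : p⁻¹.toReal ≤ 1 := by
    simpa using ENNReal.toReal_mono ENNReal.one_ne_top (ENNReal.inv_le_one.2 hp)
  have h2 : 0 ≤ p⁻¹.toReal := ENNReal.toReal_nonneg
  have h3 : 0 < 1 / s := by positivity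
  have h4 : 1 / s ≤ 1 := (div_le_one (by linarith)).2 hs
  exact ⟨h2, h1, h3, h4, abs_le.2 ⟨by linarith, by linarith⟩⟩

theorem exists_one_add_log_le {r : ℕ} (hr : 1 ≤ r) {s μ : ℝ} (hs : 1 ≤ s) {p : ℝ≥0∞} (hp : 1 ≤ p)
    (hβ : 0 < μ - p⁻¹.toReal + 1 / s) {c δ₀ : ℝ} (hc : 0 < c) (hδ₀ : 0 < δ₀) (hδ₁ : δ₀ < 1) :
    ∃ K : ℝ, 0 < K ∧ ∀ δ : ℝ, 0 < δ → δ ≤ δ₀ → ∀ n : ℕ, 1 ≤ n →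
      (n : ℝ) ≤ c * levelOrder s μ p δ → 1 + Real.log (r * n : ℕ) ≤ K * Real.log (1 / δ) := by
  have hl₀ := log_one_div_pos hδ₀ hδ₁
  set l₀ := Real.log (1 / δ₀) with hl₀d
  set β := μ - p⁻¹.toReal + 1 / s with hβd
  refine ⟨(1 + |Real.log r| + |Real.log c|) / l₀ + 1 / β * (2 + 1 / l₀ ^ 2), by positivity, ?_⟩
  intro δ h0 hδ n hn hnX
  have h1 : δ < 1 := hδ.trans_lt hδ₁
  have hX : 0 < levelOrder s μ p δ := levelOrder_pos h0 h1
  have hlog := log_levelOrder (s := s) (μ := μ) (p := p) h0 h1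
  have hle : l₀ ≤ Real.log (1 / δ) :=
    Real.log_le_log (by positivity) (one_div_le_one_div_of_le h0 hδ)
  have hγ := (abs_inv_toReal_sub_le hs hp).2.2.2.2
  rw [← hβd] at hlog
  set l := Real.log (1 / δ) with hld
  have hl : 0 < l := hl₀.trans_le hle
  have hr0 : (0 : ℝ) < r := by exact_mod_cast hr
  have hn0 : (0 : ℝ) < n := by exact_mod_cast hn
  have e1 : Real.log n ≤ Real.log c + Real.log (levelOrder s μ p δ) := by
    rw [← Real.log_mul hc.ne' hX.ne']
    exact Real.log_le_log hn0 hnX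
  have e2 : (1 : ℝ) ≤ l / l₀ := (one_le_div hl₀).2 hle
  -- Here `l` is only bounded below by `l₀`, possibly less than `1`, so `ln l` may be negative; the
  -- second summand covers that case.
  have e3 : |Real.log l| ≤ l + l / l₀ ^ 2 := by
    have a1 : Real.log l ≤ l := Real.log_le_self hl.le
    have a2 : -Real.log l ≤ 1 / l := by
      rw [← Real.log_inv, ← one_div]
      exact Real.log_le_self (by positivity)
    have a3 : 1 / l ≤ l / l₀ ^ 2 := by
      rw [div_le_div_iff₀ hl (by positivity)]
      nlinarith
    have a4 : 0 ≤ l / l₀ ^ 2 := by positivity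
    exact abs_le.2 ⟨by linarith, by linarith⟩
  have e4 : (p⁻¹.toReal - 1 / s) * Real.log l ≤ l + l / l₀ ^ 2 := by
    refine (le_abs_self _).trans ?_
    rw [abs_mul]
    exact (mul_le_of_le_one_left (abs_nonneg _) hγ).trans e3
  have e5 : 1 / β * (l + (p⁻¹.toReal - 1 / s) * Real.log l) ≤
      1 / β * (l + (l + l / l₀ ^ 2)) := by gcongr
  have e6 : 1 + |Real.log r| + |Real.log c| ≤ (1 + |Real.log r| + |Real.log c|) * (l / l₀) :=
    le_mul_of_one_le_right (by positivity) e2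
  have e7 := le_abs_self (Real.log r)
  have e8 := le_abs_self (Real.log c)
  have e9 : ((1 + |Real.log r| + |Real.log c|) / l₀ + 1 / β * (2 + 1 / l₀ ^ 2)) * l =
      (1 + |Real.log r| + |Real.log c|) * (l / l₀) + 1 / β * (l + (l + l / l₀ ^ 2)) := by
    field_simp
    ring
  rw [e9, Nat.cast_mul, Real.log_mul hr0.ne' hn0.ne']
  linarith

/-- With `l = ln (1/δ)`, `β ln X = l + (1/p - 1/s) ln l`. For large `l` the `ln l` term and the
constants `ln c₁`, `ln c₂` each perturb this by at most `l / 4`, so `β ln n` lies between `l / 2`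
and `2 l`. -/
theorem exists_log_bounds {s μ : ℝ} (hs : 1 ≤ s) {p : ℝ≥0∞} (hp : 1 ≤ p)
    (hβ : 0 < μ - p⁻¹.toReal + 1 / s) {c₁ c₂ : ℝ} (hc₁ : 0 < c₁) (hc₂ : 0 < c₂) (A : ℝ) :
    ∃ δ₁ : ℝ, 0 < δ₁ ∧ δ₁ < 1 ∧ ∀ δ : ℝ, 0 < δ → δ ≤ δ₁ → ∀ n : ℕ,
      c₁ * levelOrder s μ p δ ≤ n → (n : ℝ) ≤ c₂ * levelOrder s μ p δ →
      A ≤ Real.log n ∧ Real.log (1 / δ) / (2 * (μ - p⁻¹.toReal + 1 / s)) ≤ Real.log n ∧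
        Real.log n ≤ 2 * Real.log (1 / δ) / (μ - p⁻¹.toReal + 1 / s) := by
  set β := μ - p⁻¹.toReal + 1 / s with hβd
  have hev : ∀ᶠ l : ℝ in Filter.atTop, 1 ≤ l ∧ |Real.log l| ≤ l / 4 ∧
      |Real.log c₁| * β ≤ l / 4 ∧ |Real.log c₂| * β ≤ l / 4 ∧ A * (2 * β) ≤ l := by
    have h := Real.isLittleO_log_id_atTop.bound (by norm_num : (0 : ℝ) < 1 / 4)
    filter_upwards [h, Filter.eventually_ge_atTop 1,
      Filter.eventually_ge_atTop (4 * (|Real.log c₁| * β)),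
      Filter.eventually_ge_atTop (4 * (|Real.log c₂| * β)),
      Filter.eventually_ge_atTop (A * (2 * β))] with l h1 h2 h3 h4 h5
    rw [Real.norm_eq_abs, id, Real.norm_of_nonneg (by linarith)] at h1
    exact ⟨h2, by linarith, by linarith, by linarith, h5⟩
  obtain ⟨l₁, hl₁⟩ := Filter.eventually_atTop.1 hev
  -- The maximum with `1` keeps `δ₁ < 1`.
  refine ⟨Real.exp (-max l₁ 1), Real.exp_pos _, by simp, ?_⟩
  intro δ h0 hδ n hn1 hn2
  have h1 : δ < 1 := hδ.trans_lt (by simp)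
  have hX : 0 < levelOrder s μ p δ := levelOrder_pos h0 h1
  have hlog := log_levelOrder (s := s) (μ := μ) (p := p) h0 h1
  have hγ := (abs_inv_toReal_sub_le hs hp).2.2.2.2
  have hl : l₁ ≤ Real.log (1 / δ) := by
    rw [one_div, Real.log_inv]
    have := Real.log_le_log h0 hδ
    rw [Real.log_exp] at this
    linarith [le_max_left l₁ 1]
  obtain ⟨g1, g2, g3, g4, g5⟩ := hl₁ _ hl
  rw [← hβd] at hlog
  set l := Real.log (1 / δ) with hld
  have hn0 : (0 : ℝ) < n := (mul_pos hc₁ hX).trans_le hn1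
  have e1 : Real.log n ≤ Real.log c₂ + Real.log (levelOrder s μ p δ) := by
    rw [← Real.log_mul hc₂.ne' hX.ne']
    exact Real.log_le_log hn0 hn2
  have e2 : Real.log c₁ + Real.log (levelOrder s μ p δ) ≤ Real.log n := by
    rw [← Real.log_mul hc₁.ne' hX.ne']
    exact Real.log_le_log (mul_pos hc₁ hX) hn1
  have e3 : |(p⁻¹.toReal - 1 / s) * Real.log l| ≤ l / 4 := by
    rw [abs_mul]
    exact (mul_le_of_le_one_left (abs_nonneg _) hγ).trans g2
  obtain ⟨e4, e5⟩ := abs_le.1 e3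
  have e6 : Real.log (levelOrder s μ p δ) * β = l + (p⁻¹.toReal - 1 / s) * Real.log l := by
    rw [hlog]
    field_simp
  have e7 := mul_le_mul_of_nonneg_right (le_abs_self (Real.log c₂)) hβ.le
  have e8 := mul_le_mul_of_nonneg_right (neg_abs_le (Real.log c₁)) hβ.le
  have e9 := mul_le_mul_of_nonneg_right e1 hβ.le
  have e10 := mul_le_mul_of_nonneg_right e2 hβ.le
  have lower : l / (2 * β) ≤ Real.log n := by
    rw [div_le_iff₀ (by positivity)]
    nlinarith
  refine ⟨le_trans ?_ lower, lower, ?_⟩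
  · rwa [le_div_iff₀ (by positivity)]
  · rw [le_div_iff₀ hβ]
    nlinarith

/-! ### Truncation error, noise error and their balance. -/

theorem sum_rpow_mul_abs_coeff_le {s μ : ℝ} (hs : 1 ≤ s) {f : L2Q} (hf : f ∈ smoothClass s μ)
    (F : Finset (ℕ × ℕ)) (hF : ∀ i ∈ F, 1 ≤ i.1 ∧ 1 ≤ i.2) :
    ∑ i ∈ F, ((i.1 * i.2 : ℕ) : ℝ) ^ (s * μ) * |coeff f i| ^ s ≤ 1 := by
  obtain ⟨hsum, hle⟩ := hf
  have hnn : ∀ i, 0 ≤ normTerm s μ f i := fun i => by unfold normTerm; positivity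
  have h1 : ∑' i, normTerm s μ f i ≤ 1 := by
    by_contra! h
    exact absurd (Real.one_lt_rpow h (by positivity : 0 < 1 / s)) (not_lt.2 hle)
  refine le_trans (le_of_eq ?_) ((hsum.sum_le_tsum F fun i _ => hnn i).trans h1)
  refine Finset.sum_congr rfl fun i hi => ?_
  have : (1 : ℝ) ≤ ((i.1 * i.2 : ℕ) : ℝ) := by
    exact_mod_cast Nat.mul_pos (hF i hi).1 (hF i hi).2
  rw [normTerm, max_eq_right this]

theorem sum_norm_coeff_smul_le {r : ℕ} (hr : 1 ≤ r) {s μ : ℝ} (hs : 1 ≤ s)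
    (hμ : 2 * (r : ℝ) - 1 / s + 1 / 2 < μ) {f : L2Q} (hf : f ∈ smoothClass s μ) {N : ℕ}
    (hN : 1 ≤ N) (F : Finset (ℕ × ℕ)) (hF : ∀ i ∈ F, r ≤ i.1 ∧ r ≤ i.2 ∧ N ≤ i.1 * i.2) :
    ∑ i ∈ F, ‖coeff f i • legendreDerivL2 r i‖ ≤
      4 * tailConst (μ - 2 * r + 1 / s - 1 / 2) *
        ((N : ℝ) ^ (-(μ - 2 * r + 1 / s - 1 / 2)) * (1 + Real.log N) ^ (1 - 1 / s)) := by
  have eκ : μ - (2 * (r : ℝ) - 1 / 2) - (1 - 1 / s) = μ - 2 * r + 1 / s - 1 / 2 := by ring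
  have h := sum_tail_le (b := 2 * (r : ℝ) - 1 / 2) hs (by linarith) (coeff f) hN F
    (fun i hi => ⟨hr.trans (hF i hi).1, hr.trans (hF i hi).2.1, (hF i hi).2.2⟩)
    (sum_rpow_mul_abs_coeff_le hs hf F
      fun i hi => ⟨hr.trans (hF i hi).1, hr.trans (hF i hi).2.1⟩)
  rw [eκ] at h
  calc ∑ i ∈ F, ‖coeff f i • legendreDerivL2 r i‖
      ≤ ∑ i ∈ F, 4 * (|coeff f i| * ((i.1 * i.2 : ℕ) : ℝ) ^ (2 * (r : ℝ) - 1 / 2)) := by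
        refine Finset.sum_le_sum fun i hi => ?_
        rw [norm_smul, Real.norm_eq_abs, mul_left_comm]
        exact mul_le_mul_of_nonneg_left
          (norm_legendreDerivL2_le hr (hr.trans (hF i hi).1) (hr.trans (hF i hi).2.1))
          (abs_nonneg _)
    _ = 4 * ∑ i ∈ F, |coeff f i| * ((i.1 * i.2 : ℕ) : ℝ) ^ (2 * (r : ℝ) - 1 / 2) := by
        rw [Finset.mul_sum]
    _ ≤ _ := by
        rw [mul_assoc]
        gcongr

/-- The tail estimate from `N = 1` bounds all finite sums of norms, so the convergence is absolute,
hence unconditional. -/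
theorem summable_norm_mixedDerivTerm {r : ℕ} (hr : 1 ≤ r) {s μ : ℝ} (hs : 1 ≤ s)
    (hμ : 2 * (r : ℝ) - 1 / s + 1 / 2 < μ) {f : L2Q} (hf : f ∈ smoothClass s μ) :
    Summable fun i => ‖mixedDerivTerm r f i‖ := by
  refine summable_of_sum_le (c := 4 * tailConst (μ - 2 * r + 1 / s - 1 / 2) *
    (((1 : ℕ) : ℝ) ^ (-(μ - 2 * r + 1 / s - 1 / 2)) * (1 + Real.log (1 : ℕ)) ^ (1 - 1 / s)))
    (fun i => norm_nonneg _) fun F => ?_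
  have h := sum_norm_coeff_smul_le hr hs hμ hf le_rfl (F.map (Function.Embedding.subtype _))
    (fun i hi => by
      obtain ⟨j, _, rfl⟩ := Finset.mem_map.1 hi
      have hj := j.2
      rw [mem_Ici, Prod.le_def] at hj
      exact ⟨hj.1, hj.2, Nat.mul_pos (hr.trans hj.1) (hr.trans hj.2)⟩)
  rw [Finset.sum_map] at h
  exact h

theorem norm_mixedDeriv_sub_sum_le {r : ℕ} (hr : 1 ≤ r) {s μ : ℝ} (hs : 1 ≤ s)
    (hμ : 2 * (r : ℝ) - 1 / s + 1 / 2 < μ) {f : L2Q} (hf : f ∈ smoothClass s μ) {n : ℕ}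
    (hn : 1 ≤ n) :
    ‖mixedDeriv r f - truncation r n (coeff f)‖ ≤
      4 * tailConst (μ - 2 * r + 1 / s - 1 / 2) *
        (((r * n : ℕ) : ℝ) ^ (-(μ - 2 * r + 1 / s - 1 / 2)) *
          (1 + Real.log (r * n : ℕ)) ^ (1 - 1 / s)) := by
  classical
  set Γ := hyperbolicCross r n with hΓ
  set S : Set (ℕ × ℕ) := Ici (r, r) with hS
  set g : ℕ × ℕ → L2Q := fun i => coeff f i • legendreDerivL2 r i with hg
  set g' : ℕ × ℕ → L2Q := S.indicator g with hg'
  have hsum : Summable g' :=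
    summable_subtype_iff_indicator.1 (summable_norm_mixedDerivTerm hr hs hμ hf).of_norm
  have e1 : mixedDeriv r f = ∑' i, g' i := tsum_subtype S g
  have e2 : truncation r n (coeff f) = ∑ i ∈ Γ, g' i := by
    refine Finset.sum_congr rfl fun i hi => ?_
    have hi' := mem_hyperbolicCross.1 hi
    exact (indicator_of_mem (show i ∈ S from Prod.le_def.2 ⟨hi'.1, hi'.2.1⟩) g).symm
  -- An index with `k, j ≥ r` outside the cross has `k j ≥ r n`, so the tail estimate applies with
  -- `N = r n`.
  have hB : ∀ F : Finset {i // i ∉ Γ}, ∑ i ∈ F, ‖g' i‖ ≤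
      4 * tailConst (μ - 2 * r + 1 / s - 1 / 2) *
        (((r * n : ℕ) : ℝ) ^ (-(μ - 2 * r + 1 / s - 1 / 2)) *
          (1 + Real.log (r * n : ℕ)) ^ (1 - 1 / s)) := by
    intro F
    refine le_trans (le_of_eq ?_) (sum_norm_coeff_smul_le hr hs hμ hf (Nat.mul_pos hr hn)
      ((F.map (Function.Embedding.subtype _)).filter (· ∈ S)) ?_)
    · rw [Finset.sum_filter, Finset.sum_map]
      refine Finset.sum_congr rfl fun i _ => ?_
      by_cases hi : (i : ℕ × ℕ) ∈ S <;> simp [hg', hg, hi]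
    · intro i hi
      obtain ⟨hi, hiS⟩ := Finset.mem_filter.1 hi
      obtain ⟨j, _, rfl⟩ := Finset.mem_map.1 hi
      have hj := j.2
      have hjS := Prod.le_def.1 (mem_Ici.1 hiS)
      refine ⟨hjS.1, hjS.2, ?_⟩
      by_contra! h
      exact hj (mem_hyperbolicCross.2 ⟨hjS.1, hjS.2, h⟩)
  rw [e1, e2, ← hsum.sum_add_tsum_subtype_compl Γ, add_sub_cancel_left]
  exact (norm_tsum_le_tsum_norm (summable_of_sum_le (fun i => norm_nonneg _) hB)).trans
    (Real.tsum_le_of_sum_le (fun i => norm_nonneg _) hB)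

theorem norm_truncation_sub_le {r : ℕ} (hr : 1 ≤ r) {p : ℝ≥0∞} (hp : 1 ≤ p) {δ : ℝ}
    {x y : ℕ × ℕ → ℝ} (h : IsPerturbation p δ x y) (n : ℕ) :
    ‖truncation r n x - truncation r n y‖ ≤
      4 * ((r * n : ℕ) : ℝ) ^ (2 * (r : ℝ) - 1 / 2) *
        (((r * n : ℕ) * (1 + Real.log (r * n : ℕ))) ^ (1 - p⁻¹.toReal) * δ) := by
  obtain ⟨ξ, hξ, hδ⟩ := h
  have hr1 : (1 : ℝ) ≤ r := by exact_mod_cast hr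
  have hp1 := (abs_inv_toReal_sub_le le_rfl hp).2.1
  have e : truncation r n x - truncation r n y =
      ∑ i ∈ hyperbolicCross r n, ξ i • legendreDerivL2 r i := by
    rw [truncation, truncation, ← Finset.sum_sub_distrib]
    refine Finset.sum_congr rfl fun i _ => ?_
    rw [hξ, sub_smul]
  rw [e]
  calc ‖∑ i ∈ hyperbolicCross r n, ξ i • legendreDerivL2 r i‖
      ≤ ∑ i ∈ hyperbolicCross r n, 4 * ((r * n : ℕ) : ℝ) ^ (2 * (r : ℝ) - 1 / 2) * |ξ i| := by
        refine norm_sum_le_of_le _ fun i hi => ?_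
        obtain ⟨h1, h2, h3⟩ := mem_hyperbolicCross.1 hi
        rw [norm_smul, Real.norm_eq_abs, mul_comm]
        refine mul_le_mul_of_nonneg_right
          ((norm_legendreDerivL2_le hr (hr.trans h1) (hr.trans h2)).trans ?_) (abs_nonneg _)
        have : ((i.1 * i.2 : ℕ) : ℝ) ≤ ((r * n : ℕ) : ℝ) := by exact_mod_cast h3.le
        have : 0 ≤ 2 * (r : ℝ) - 1 / 2 := by linarith
        gcongr
    _ = 4 * ((r * n : ℕ) : ℝ) ^ (2 * (r : ℝ) - 1 / 2) * ∑ i ∈ hyperbolicCross r n, |ξ i| := by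
        rw [Finset.mul_sum]
    _ ≤ _ := by
        have hl : 0 ≤ Real.log ((r * n : ℕ) : ℝ) := Real.log_natCast_nonneg _
        have hq : 0 ≤ 1 - p⁻¹.toReal := by linarith
        gcongr
        refine (sum_abs_le_of_mem_lp hp ξ _).trans ?_
        refine mul_le_mul (Real.rpow_le_rpow (by positivity) (card_hyperbolicCross_le hr) hq) hδ
          (lp.norm_nonneg' ξ) (by positivity)

theorem exists_norm_mixedDeriv_sub_truncation_le {r : ℕ} (hr : 1 ≤ r) {s μ : ℝ} (hs : 1 ≤ s)
    (hμ : 2 * (r : ℝ) - 1 / s + 1 / 2 < μ) {p : ℝ≥0∞} (hp : 1 ≤ p) {c₁ c₂ δ₀ : ℝ} (hc₁ : 0 < c₁)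
    (hc₂ : 0 < c₂) (hδ₀ : 0 < δ₀) (hδ₁ : δ₀ < 1) :
    ∃ C : ℝ, 0 < C ∧ ∀ δ : ℝ, 0 < δ → δ ≤ δ₀ → ∀ n : ℕ, c₁ * levelOrder s μ p δ ≤ n →
      (n : ℝ) ≤ c₂ * levelOrder s μ p δ → ∀ f ∈ smoothClass s μ, ∀ y : ℕ × ℕ → ℝ,
        IsPerturbation p δ (coeff f) y →
        ‖mixedDeriv r f - truncation r n y‖ ≤ C * accuracyOrder r s μ p δ := by
  obtain ⟨hp0, hp1, hs0, hs1, hγ⟩ := abs_inv_toReal_sub_le hs hp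
  have hr1 : (1 : ℝ) ≤ r := by exact_mod_cast hr
  have hβ : 0 < μ - p⁻¹.toReal + 1 / s := by linarith
  obtain ⟨K, hK, hlogK⟩ := exists_one_add_log_le hr hs hp hβ hc₂ hδ₀ hδ₁
  set κ := μ - 2 * r + 1 / s - 1 / 2 with hκd
  have hκ : 0 < κ := by linarith
  set q := p⁻¹.toReal with hq
  have hl₀ := log_one_div_pos hδ₀ hδ₁
  set l₀ := Real.log (1 / δ₀) with hl₀d
  set C₁ := 4 * tailConst κ * (c₁ ^ (-κ) * K ^ (1 - 1 / s)) with hC₁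
  set C₂ := 4 * (r * c₂) ^ (2 * (r : ℝ) - 1 / 2 + (1 - q)) * K ^ (1 - q) with hC₂
  have hC₁0 : 0 ≤ C₁ := mul_nonneg (mul_nonneg (by norm_num) (tailConst_nonneg κ)) (by positivity)
  have hC₂0 : 0 < C₂ := by positivity
  refine ⟨(C₁ + C₂) * l₀ ^ (-(1 / 2 : ℝ)), by positivity, ?_⟩
  intro δ h0 hδ n hn1 hn2 f hf y hy
  have h1 : δ < 1 := hδ.trans_lt hδ₁
  have hX : 0 < levelOrder s μ p δ := levelOrder_pos h0 h1
  have hXβ := levelOrder_rpow h0 h1 hβ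
  rw [accuracyOrder_eq h0 h1, ← hκd]
  have hle : l₀ ≤ Real.log (1 / δ) :=
    Real.log_le_log (by positivity) (one_div_le_one_div_of_le h0 hδ)
  have hn0 : (0 : ℝ) < n := (mul_pos hc₁ hX).trans_le hn1
  have hn : 1 ≤ n := by exact_mod_cast hn0
  have hlog := hlogK δ h0 hδ n hn hn2
  set X := levelOrder s μ p δ with hXd
  set l := Real.log (1 / δ) with hld
  have hl : 0 < l := hl₀.trans_le hle
  have hlogn : 0 ≤ Real.log ((r * n : ℕ) : ℝ) := Real.log_natCast_nonneg _
  -- Solving the definition of `X` for `δ` turns the noise bound into powers of `X` and `l`, whose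
  -- exponents add up to `-κ` and `1 - 1 / s`, as in the tail.
  have hδX : δ = X ^ (-(μ - q + 1 / s)) * l ^ (q - 1 / s) := by
    rw [Real.rpow_neg hX.le, hXβ, mul_inv, inv_inv, mul_assoc, inv_mul_cancel₀ (by positivity),
      mul_one]
  have hs1' : 0 ≤ 1 - 1 / s := by linarith
  have hq1' : 0 ≤ 1 - q := by linarith
  have tail : ‖mixedDeriv r f - truncation r n (coeff f)‖ ≤ C₁ * (X ^ (-κ) * l ^ (1 - 1 / s)) := by
    refine (norm_mixedDeriv_sub_sum_le hr hs hμ hf hn).trans ?_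
    have hcX : c₁ * X ≤ ((r * n : ℕ) : ℝ) := by
      push_cast
      nlinarith
    have e1 : ((r * n : ℕ) : ℝ) ^ (-κ) ≤ c₁ ^ (-κ) * X ^ (-κ) := by
      rw [← Real.mul_rpow hc₁.le hX.le]
      exact Real.rpow_le_rpow_of_nonpos (by positivity) hcX (by linarith)
    have e2 : (1 + Real.log ((r * n : ℕ) : ℝ)) ^ (1 - 1 / s) ≤
        K ^ (1 - 1 / s) * l ^ (1 - 1 / s) := by
      rw [← Real.mul_rpow hK.le hl.le]
      gcongr
    calc _ ≤ 4 * tailConst κ * ((c₁ ^ (-κ) * X ^ (-κ)) * (K ^ (1 - 1 / s) * l ^ (1 - 1 / s))) := by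
          have := tailConst_nonneg κ
          gcongr
      _ = _ := by rw [hC₁]; ring
  have noise : ‖truncation r n (coeff f) - truncation r n y‖ ≤
      C₂ * (X ^ (-κ) * l ^ (1 - 1 / s)) := by
    refine (norm_truncation_sub_le hr hp hy n).trans ?_
    have hcX : ((r * n : ℕ) : ℝ) ≤ r * c₂ * X := by
      push_cast
      nlinarith
    have hb : 0 ≤ 2 * (r : ℝ) - 1 / 2 := by linarith
    calc _ ≤ 4 * (r * c₂ * X) ^ (2 * (r : ℝ) - 1 / 2) * ((r * c₂ * X * (K * l)) ^ (1 - q) * δ) := by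
          gcongr
      _ = C₂ * ((X ^ (2 * (r : ℝ) - 1 / 2) * X ^ (1 - q) * X ^ (-(μ - q + 1 / s))) *
            (l ^ (1 - q) * l ^ (q - 1 / s))) := by
          conv_lhs => rw [hδX]
          rw [Real.mul_rpow (x := r * c₂ * X) (by positivity) (by positivity),
            Real.mul_rpow (x := K) hK.le hl.le,
            Real.mul_rpow (x := r * c₂) (by positivity) hX.le,
            Real.mul_rpow (x := r * c₂) (by positivity) hX.le, hC₂,
            Real.rpow_add (x := r * c₂) (by positivity)]
          ring
      _ = _ := by
          rw [← Real.rpow_add hX, ← Real.rpow_add hX, ← Real.rpow_add hl]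
          congr 3
          · rw [hκd]; ring
          · ring
  -- The unused half power of `l` is bounded below by `l₀ ^ (1/2)`.
  have hspare : l ^ (1 - 1 / s) ≤ l₀ ^ (-(1 / 2 : ℝ)) * l ^ (3 / 2 - 1 / s) := by
    rw [show (3 / 2 - 1 / s : ℝ) = 1 / 2 + (1 - 1 / s) by ring, Real.rpow_add hl, ← mul_assoc]
    refine le_mul_of_one_le_left (by positivity) ?_
    rw [Real.rpow_neg hl₀.le, ← div_eq_inv_mul, one_le_div (by positivity)]
    gcongr
  calc ‖mixedDeriv r f - truncation r n y‖
      ≤ ‖mixedDeriv r f - truncation r n (coeff f)‖ +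
          ‖truncation r n (coeff f) - truncation r n y‖ := norm_sub_le_norm_sub_add_norm_sub _ _ _
    _ ≤ (C₁ + C₂) * (X ^ (-κ) * l ^ (1 - 1 / s)) := by linarith
    _ ≤ (C₁ + C₂) * (X ^ (-κ) * (l₀ ^ (-(1 / 2 : ℝ)) * l ^ (3 / 2 - 1 / s))) := by gcongr
    _ = _ := by ring

theorem exists_card_hyperbolicCross_bounds {r : ℕ} (hr : 1 ≤ r) {s μ : ℝ} (hs : 1 ≤ s)
    {p : ℝ≥0∞} (hp : 1 ≤ p) (hβ : 0 < μ - p⁻¹.toReal + 1 / s) {c₁ c₂ : ℝ} (hc₁ : 0 < c₁)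
    (hc₂ : 0 < c₂) :
    ∃ a b δ₁ : ℝ, 0 < a ∧ 0 < b ∧ 0 < δ₁ ∧ δ₁ < 1 ∧
      ∀ δ : ℝ, 0 < δ → δ ≤ δ₁ →
      ∀ n : ℕ, c₁ * levelOrder s μ p δ ≤ n → (n : ℝ) ≤ c₂ * levelOrder s μ p δ →
        (a * (n * Real.log n) ≤ ((hyperbolicCross r n).card : ℝ) ∧
          ((hyperbolicCross r n).card : ℝ) ≤ b * (n * Real.log n)) ∧
        (a * cardOrder s μ p δ ≤ n * Real.log n ∧
          n * Real.log n ≤ b * cardOrder s μ p δ) := by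
  -- The threshold `ln n ≥ 2 (r + 1)` makes `ln n - r - 1` at least `ln n / 2`, and also absorbs `1
  -- + ln r` into `ln n`.
  obtain ⟨δ₁, hδ0, hδ1, H⟩ := exists_log_bounds hs hp hβ hc₁ hc₂ (2 * ((r : ℝ) + 1))
  have hr1 : (1 : ℝ) ≤ r := by exact_mod_cast hr
  set β := μ - p⁻¹.toReal + 1 / s with hβd
  refine ⟨min (1 / 2) (c₁ / (2 * β)), max (2 * r) (c₂ * 2 / β), δ₁, by positivity,
    lt_max_of_lt_left (by positivity), hδ0, hδ1, ?_⟩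
  intro δ h0 hδ n hn1 hn2
  have h1 : δ < 1 := hδ.trans_lt hδ1
  have hX : 0 < levelOrder s μ p δ := levelOrder_pos h0 h1
  have hl := log_one_div_pos h0 h1
  obtain ⟨g1, g2, g3⟩ := H δ h0 hδ n hn1 hn2
  rw [cardOrder_eq h0 h1 hβ]
  have hn0 : (0 : ℝ) < n := (mul_pos hc₁ hX).trans_le hn1
  have hn : 1 ≤ n := by exact_mod_cast hn0
  have hlog : 0 < Real.log n := by linarith
  set l := Real.log (1 / δ) with hld
  set X := levelOrder s μ p δ with hXd
  have hnl : 0 < n * Real.log n := mul_pos hn0 hlog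
  refine ⟨⟨?_, ?_⟩, ?_, ?_⟩
  · refine (mul_le_mul_of_nonneg_right (min_le_left _ _) hnl.le).trans
      (le_trans ?_ (le_card_hyperbolicCross hr hn))
    have e1 : Real.log n / 2 ≤ Real.log n - r - 1 := by linarith
    calc 1 / 2 * (n * Real.log n) = 1 * n * (Real.log n / 2) := by ring
      _ ≤ r * n * (Real.log n - r - 1) := by gcongr
  · refine le_trans (card_hyperbolicCross_le hr)
      (le_trans ?_ (mul_le_mul_of_nonneg_right (le_max_left _ _) hnl.le))
    have e1 : Real.log r ≤ r := Real.log_le_self (by linarith)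
    push_cast
    rw [Real.log_mul (by positivity) hn0.ne']
    calc (r : ℝ) * n * (1 + (Real.log r + Real.log n)) ≤ r * n * (2 * Real.log n) := by
          gcongr
          linarith
      _ = _ := by ring
  · refine (mul_le_mul_of_nonneg_right (min_le_right _ _) (by positivity)).trans ?_
    calc c₁ / (2 * β) * (X * l) = (c₁ * X) * (l / (2 * β)) := by ring
      _ ≤ n * Real.log n := by gcongr
  · refine le_trans ?_ (mul_le_mul_of_nonneg_right (le_max_right _ _) (by positivity))
    calc n * Real.log n ≤ (c₂ * X) * (2 * l / β) := by gcongr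
      _ = _ := by ring

end MixedDeriv

theorem corollary1 (r : ℕ) (hr : 1 ≤ r) (s μ : ℝ) (hs : 1 ≤ s)
    (hμ : 2 * (r : ℝ) - 1 / s + 1 / 2 < μ) (p : ℝ≥0∞) (hp : 1 ≤ p)
    (c₁ c₂ : ℝ) (hc₁ : 0 < c₁) :
    -- the series defining `f^{(r,r)}` converges in `L₂(Q)` on the whole class
    (∀ f ∈ MixedDeriv.smoothClass s μ, Summable (MixedDeriv.mixedDerivTerm r f)) ∧
    -- accuracy, uniformly over the class and over all perturbations, for `δ` away from `1`
    (∀ δ₀ : ℝ, 0 < δ₀ → δ₀ < 1 → ∃ C : ℝ, 0 < C ∧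
      ∀ δ : ℝ, 0 < δ → δ ≤ δ₀ →
      ∀ n : ℕ, c₁ * MixedDeriv.levelOrder s μ p δ ≤ n →
        (n : ℝ) ≤ c₂ * MixedDeriv.levelOrder s μ p δ →
      ∀ f ∈ MixedDeriv.smoothClass s μ, ∀ y : ℕ × ℕ → ℝ,
        MixedDeriv.IsPerturbation p δ (MixedDeriv.coeff f) y →
        ‖MixedDeriv.mixedDeriv r f - MixedDeriv.truncation r n y‖
          ≤ C * MixedDeriv.accuracyOrder r s μ p δ) ∧
    -- number of perturbed coefficients, for all small `δ`
    (∃ a b δ₁ : ℝ, 0 < a ∧ 0 < b ∧ 0 < δ₁ ∧ δ₁ < 1 ∧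
      ∀ δ : ℝ, 0 < δ → δ ≤ δ₁ →
      ∀ n : ℕ, c₁ * MixedDeriv.levelOrder s μ p δ ≤ n →
        (n : ℝ) ≤ c₂ * MixedDeriv.levelOrder s μ p δ →
        (a * (n * Real.log n) ≤ ((MixedDeriv.hyperbolicCross r n).card : ℝ) ∧
          ((MixedDeriv.hyperbolicCross r n).card : ℝ) ≤ b * (n * Real.log n)) ∧
        (a * MixedDeriv.cardOrder s μ p δ ≤ n * Real.log n ∧
          n * Real.log n ≤ b * MixedDeriv.cardOrder s μ p δ)) := by
  obtain ⟨hp0, hp1, hs0, hs1, -⟩ := MixedDeriv.abs_inv_toReal_sub_le hs hp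
  have hr1 : (1 : ℝ) ≤ r := by exact_mod_cast hr
  have hβ : 0 < μ - p⁻¹.toReal + 1 / s := by linarith
  -- The sign of `c₂` is not prescribed; enlarging it to a positive constant only admits more `n`.
  have hc₂ : 0 < max c₂ 1 := by positivity
  have hmono : ∀ δ : ℝ, 0 < δ → δ < 1 → ∀ n : ℕ, (n : ℝ) ≤ c₂ * MixedDeriv.levelOrder s μ p δ →
      (n : ℝ) ≤ max c₂ 1 * MixedDeriv.levelOrder s μ p δ := fun δ h0 h1 n hn =>
    hn.trans (mul_le_mul_of_nonneg_right (le_max_left _ _) (MixedDeriv.levelOrder_pos h0 h1).le)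
  refine ⟨fun f hf => (MixedDeriv.summable_norm_mixedDerivTerm hr hs hμ hf).of_norm, ?_, ?_⟩
  · intro δ₀ hδ₀ hδ₁
    obtain ⟨C, hC, H⟩ :=
      MixedDeriv.exists_norm_mixedDeriv_sub_truncation_le hr hs hμ hp hc₁ hc₂ hδ₀ hδ₁
    exact ⟨C, hC, fun δ h0 hδ n hn1 hn2 =>
      H δ h0 hδ n hn1 (hmono δ h0 (hδ.trans_lt hδ₁) n hn2)⟩
  · obtain ⟨a, b, δ₁, ha, hb, h0, h1, H⟩ :=
      MixedDeriv.exists_card_hyperbolicCross_bounds hr hs hp hβ hc₁ hc₂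
    exact ⟨a, b, δ₁, ha, hb, h0, h1, fun δ hδ0 hδ n hn1 hn2 =>
      H δ hδ0 hδ n hn1 (hmono δ hδ0 (hδ.trans_lt h1) n hn2)⟩
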